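/- A partially ordered abelian group is an abelian group with a translation-invariant partial order. It is called simple if every element $e>0$ is an order-unit, i.e. for every element $x$ there is an integer $n\geq 1$ with $x\leq ne$. A Riesz group is a partially ordered abelian group $H$ which is directed (any two elements have a common upper bound) and has the interpolation property: whenever $x_0,x_1,y_0,y_1\in H$ satisfy $x_i\leq y_j$ for all $i,j\in\{0,1\}$, there is $z\in H$ with $x_i\leq z\leq y_j$ for all $i,j\in\{0,1\}$. The positive cone $H^+=\{a\in H: a\geq 0\}$ is called divisible if for every integer $n\geq 1$ and every $a\in H^+$ there is $b\in H^+$ with $nb=a$. Corollary 2.8. For every simple partially ordered abelian group $G$ there are a simple Riesz group $H$ with divisible positive cone and an order-embedding of $G$ into $H$, i.e. an injective group homomorphism $f:G\to H$ such that, for all $x,y\in G$, $x\leq y$ if and only if $f(x)\leq f(y)$. -/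

import Mathlib

universe u

section Definitions

variable (G : Type u) [AddCommGroup G] [PartialOrder G]

variable {G} in
/-- An order-unit: a positive element whose multiples are cofinal in the group. -/
def IsOrderUnit (e : G) : Prop :=
  0 ≤ e ∧ ∀ x : G, ∃ n : ℕ, 0 < n ∧ x ≤ n • e

/-- A partially ordered abelian group is simple when all its elements `e > 0` are order-units. -/
def IsSimplePOGroup : Prop :=
  ∀ e : G, 0 < e → IsOrderUnit e

/-- A Riesz group is a directed partially ordered abelian group with the (Riesz) interpolation
property. -/
structure IsRieszGroup : Prop where
  directed : ∀ x y : G, ∃ z : G, x ≤ z ∧ y ≤ z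
  interpolation : ∀ x₀ x₁ y₀ y₁ : G, x₀ ≤ y₀ → x₀ ≤ y₁ → x₁ ≤ y₀ → x₁ ≤ y₁ →
    ∃ z : G, x₀ ≤ z ∧ x₁ ≤ z ∧ z ≤ y₀ ∧ z ≤ y₁

/-- The monoid of elements `≥ 0` is divisible: the roots are found in the cone itself. -/
def HasDivisiblePositiveCone : Prop :=
  ∀ n : ℕ, 0 < n → ∀ a : G, 0 ≤ a → ∃ b : G, 0 ≤ b ∧ n • b = a

end Definitions

/-! Everything happens inside one large divisible group `V` containing `G`, where an order is given
by its positive cone. `H` is the subgroup generated by the union of an increasing sequence of cones,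
each solving the interpolation and division problems posed by the previous one.

To solve one problem over a subgroup `W` with cone `C`, a new element is adjoined without changing
the order on `W`. Declaring positive only what the problem demands could destroy simplicity, since a
new positive element need not have a multiple above the unit `u`. Therefore `extendCone` also makes
`φ a - k • u` positive when `k` is small compared with the weight `ℓ a`. This restores simplicity.
It adds nothing to `W`, because a combination of new generators that falls back into `W` is a sum of
old strictly positive elements, and by simplicity of `C` enough of these already exceed `k • u`.

All problems of one stage are solved together: each has its own generator, so the sum of the
separate extensions (`amalgamCone`) still meets `W` in `C`. A cardinal count provides enough
generators, and countably many stages suffice. -/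

/-! ### Simple cones in an abelian group -/

section SimpleCone

variable {V : Type*} [AddCommGroup V]

/-- A nonzero pointed cone `C` in which every nonzero element is an order-unit, the latter being
tested on a fixed element `u` of `C`. -/
structure IsSimpleCone (u : V) (C : AddSubmonoid V) : Prop where
  unit_mem : u ∈ C
  unit_ne_zero : u ≠ 0
  pointed : ∀ p ∈ C, -p ∈ C → p = 0
  dominates : ∀ e ∈ C, e ≠ 0 → ∃ n : ℕ, n • e - u ∈ C
  bounded : ∀ p ∈ C, ∃ n : ℕ, n • u - p ∈ C

namespace IsSimpleCone

variable {u : V} {C : AddSubmonoid V}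

theorem eq_zero_of_add_eq_zero (h : IsSimpleCone u C) {p q : V} (hp : p ∈ C) (hq : q ∈ C)
    (hpq : p + q = 0) : p = 0 :=
  h.pointed p hp (by rwa [neg_eq_of_add_eq_zero_right hpq])

theorem add_ne_zero (h : IsSimpleCone u C) {p q : V} (hp : p ∈ C) (hq : q ∈ C)
    (hp0 : p ≠ 0) : p + q ≠ 0 :=
  fun hpq => hp0 (h.eq_zero_of_add_eq_zero hp hq hpq)

theorem nsmul_ne_zero (h : IsSimpleCone u C) {p : V} (hp : p ∈ C) (hp0 : p ≠ 0) {n : ℕ}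
    (hn : n ≠ 0) : n • p ≠ 0 := by
  obtain ⟨m, rfl⟩ := Nat.exists_eq_succ_of_ne_zero hn
  rw [Nat.succ_eq_add_one, succ_nsmul, add_comm]
  exact h.add_ne_zero hp (C.nsmul_mem hp m) hp0

theorem eq_zero_of_sum_eq_zero (h : IsSimpleCone u C) {T : Type*} (s : Finset T) (p : T → V)
    (hp : ∀ t ∈ s, p t ∈ C) (hs : ∑ t ∈ s, p t = 0) : ∀ t ∈ s, p t = 0 := by
  classical
  intro t ht
  rw [← Finset.add_sum_erase s p ht] at hs
  exact h.eq_zero_of_add_eq_zero (hp t ht)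
    (C.sum_mem fun i hi => hp i (Finset.mem_of_mem_erase hi)) hs

theorem nsmul_sub_nsmul_mem {e : V} (he : e ∈ C) {M : ℕ}
    (hM : M • e - u ∈ C) {m k : ℕ} (hmk : M * k ≤ m) : m • e - k • u ∈ C := by
  obtain ⟨r, rfl⟩ := Nat.exists_eq_add_of_le hmk
  have : (M * k + r) • e - k • u = k • (M • e - u) + r • e := by
    rw [add_nsmul, mul_comm M k, mul_nsmul', nsmul_sub]; abel
  rw [this]
  exact C.add_mem (C.nsmul_mem hM k) (C.nsmul_mem he r)

theorem nsmul_sub_mem_of_le {e : V} (he : e ∈ C) {M M' : ℕ}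
    (hM : M • e - u ∈ C) (hMM' : M ≤ M') : M' • e - u ∈ C := by
  simpa using nsmul_sub_nsmul_mem he hM (m := M') (k := 1) (by simpa using hMM')

end IsSimpleCone

/-! ### Adjoining generators with a margin over the unit -/

section Extend

variable {A : Type*} [AddCommMonoid A]

/-- The cone generated by `C` and the elements `φ a - k • u` with `N * k < ℓ a`. -/
def extendCone (u : V) (C : AddSubmonoid V) (φ : A →+ V) (ℓ : A →+ ℕ) (N : ℕ) :
    AddSubmonoid V where
  carrier := {p | ∃ g ∈ C, ∃ (a : A) (k : ℕ), (N * k < ℓ a ∨ a = 0 ∧ k = 0) ∧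
    p = g + φ a - k • u}
  zero_mem' := ⟨0, C.zero_mem, 0, 0, Or.inr ⟨rfl, rfl⟩, by simp⟩
  add_mem' := by
    rintro _ _ ⟨g, hg, a, k, h, rfl⟩ ⟨g', hg', a', k', h', rfl⟩
    refine ⟨g + g', C.add_mem hg hg', a + a', k + k', ?_, ?_⟩
    · rcases h with h | ⟨rfl, rfl⟩
      · rcases h' with h' | ⟨rfl, rfl⟩
        · left; rw [map_add, mul_add]; omega
        · left; simpa using h
      · simpa using h'
    · rw [map_add, add_nsmul]; abel

theorem le_extendCone (u : V) (C : AddSubmonoid V) (φ : A →+ V) (ℓ : A →+ ℕ) (N : ℕ) :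
    C ≤ extendCone u C φ ℓ N :=
  fun g hg => ⟨g, hg, 0, 0, Or.inr ⟨rfl, rfl⟩, by simp⟩

theorem apply_mem_extendCone (u : V) (C : AddSubmonoid V) (φ : A →+ V) {ℓ : A →+ ℕ} (N : ℕ)
    (hℓ : ∀ a, ℓ a = 0 → a = 0) (a : A) : φ a ∈ extendCone u C φ ℓ N := by
  refine ⟨0, C.zero_mem, a, 0, ?_, by simp⟩
  by_cases ha : a = 0
  · exact Or.inr ⟨ha, rfl⟩
  · exact Or.inl (by simpa using Nat.pos_of_ne_zero (mt (hℓ a) ha))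

variable {u : V} {C : AddSubmonoid V} {W : AddSubgroup V} {φ : A →+ V} {ℓ : A →+ ℕ} {N : ℕ}

theorem mem_of_mem_extendCone (hC : IsSimpleCone u C) (hCW : ∀ p ∈ C, p ∈ W)
    (hφ : ∀ (a : A) (k : ℕ), φ a ∈ W → N * k < ℓ a → φ a - k • u ∈ C ∧ φ a - k • u ≠ 0)
    {p : V} (hp : p ∈ extendCone u C φ ℓ N) (hpW : p ∈ W) : p ∈ C := by
  obtain ⟨g, hg, a, k, h, rfl⟩ := hp
  rcases h with h | ⟨rfl, rfl⟩
  · have : φ a ∈ W := by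
      have := W.add_mem (W.sub_mem hpW (hCW g hg)) (W.nsmul_mem (hCW u hC.unit_mem) k)
      convert this using 1; abel
    rw [add_sub_assoc]
    exact C.add_mem hg (hφ a k this h).1
  · simpa using hg

/-- `hφ` says that the new generators interact with `W` only through nonzero elements of `C`, which
protects pointedness. `hb` bounds `φ a` by `φ a + φ a'`, an old element. -/
theorem isSimpleCone_extendCone (hC : IsSimpleCone u C) (hCW : ∀ p ∈ C, p ∈ W)
    (hℓ : ∀ a, ℓ a = 0 → a = 0)
    (hφ : ∀ (a : A) (k : ℕ), φ a ∈ W → N * k < ℓ a → φ a - k • u ∈ C ∧ φ a - k • u ≠ 0)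
    (hb : ∀ a, ∃ a', φ a + φ a' ∈ C) : IsSimpleCone u (extendCone u C φ ℓ N) := by
  have hle := le_extendCone u C φ ℓ N
  refine ⟨hle hC.unit_mem, hC.unit_ne_zero, ?_, ?_, ?_⟩
  · intro p hp hp'
    have hpC : p ∈ C := by
      obtain ⟨g, hg, a, k, h, rfl⟩ := hp
      obtain ⟨g', hg', a', k', h', e⟩ := hp'
      have key : (g + g') + (φ (a + a') - (k + k') • u) = 0 := by
        have : (g + φ a - k • u) + (g' + φ a' - k' • u) = 0 := by rw [← e]; abel
        rw [← this, map_add, add_nsmul]; abel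
      -- Otherwise `key` puts `φ (a + a')` in `W`, and `hφ` yields a nonzero element of `C` whose
      -- negative is `g + g'`.
      have hsum : ¬ N * (k + k') < ℓ (a + a') := by
        intro hlt
        have hW : φ (a + a') ∈ W := by
          have h1 : φ (a + a') = (k + k') • u - (g + g') := by
            rw [eq_sub_iff_add_eq, ← sub_eq_zero, ← key]; abel
          rw [h1]
          exact W.sub_mem (W.nsmul_mem (hCW u hC.unit_mem) _) (hCW _ (C.add_mem hg hg'))
        obtain ⟨h1, h2⟩ := hφ _ _ hW hlt
        rw [add_comm] at key
        exact hC.add_ne_zero h1 (C.add_mem hg hg') h2 key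
      rcases h with h | ⟨rfl, rfl⟩
      · exfalso
        apply hsum
        rcases h' with h' | ⟨rfl, rfl⟩
        · rw [map_add, mul_add]; omega
        · simpa using h
      · simpa using hg
    have hpC' : -p ∈ C := mem_of_mem_extendCone hC hCW hφ hp' (W.neg_mem (hCW p hpC))
    exact hC.pointed p hpC hpC'
  · rintro _ ⟨g, hg, a, k, h, rfl⟩ hne
    rcases h with h | ⟨rfl, rfl⟩
    -- Since `N * k + 1 ≤ ℓ a`, multiplying by `N + 1` raises the margin to at least `N + 1`, enough
    -- to pay `N` for one more `u`.
    · refine ⟨N + 1, (N + 1) • g, C.nsmul_mem hg _, (N + 1) • a, (N + 1) * k + 1, Or.inl ?_, ?_⟩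
      · rw [map_nsmul, smul_eq_mul]; nlinarith
      · rw [map_nsmul, add_nsmul u _ 1, one_nsmul, mul_nsmul', nsmul_sub, nsmul_add]; abel
    · simp only [map_zero, zero_nsmul, add_zero, sub_zero] at hne ⊢
      obtain ⟨n, hn⟩ := hC.dominates g hg hne
      exact ⟨n, hle hn⟩
  · rintro _ ⟨g, hg, a, k, h, rfl⟩
    obtain ⟨n, hn⟩ := hC.bounded g hg
    obtain ⟨a', ha'⟩ := hb a
    obtain ⟨m, hm⟩ := hC.bounded _ ha'
    refine ⟨n + m, ?_⟩
    have : (n + m) • u - (g + φ a - k • u) =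
        ((n • u - g) + (m • u - (φ a + φ a')) + k • u) + φ a' := by
      rw [add_nsmul]; abel
    rw [this]
    exact AddSubmonoid.add_mem _ (hle (C.add_mem (C.add_mem hn hm) (C.nsmul_mem hC.unit_mem k)))
      (apply_mem_extendCone u C φ N hℓ a')

end Extend

/-! ### Sums of independent extensions -/

section Amalgam

variable {T : Type*}

/-- Summation of finitely supported families. -/
noncomputable def familySum (T V : Type*) [AddCommGroup V] : (T →₀ V) →+ V :=
  Finsupp.liftAddHom fun _ => AddMonoidHom.id V

theorem familySum_single (t : T) (p : V) : familySum T V (Finsupp.single t p) = p := by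
  simp [familySum]

theorem familySum_eq_sum (f : T →₀ V) : familySum T V f = ∑ t ∈ f.support, f t := rfl

/-- The sum of a family of cones. -/
noncomputable def amalgamCone (K : T → AddSubmonoid V) : AddSubmonoid V :=
  AddSubmonoid.map (familySum T V)
    { carrier := {f | ∀ t, f t ∈ K t}
      zero_mem' := fun t => (K t).zero_mem
      add_mem' := fun hf hg t => (K t).add_mem (hf t) (hg t) }

theorem mem_amalgamCone {K : T → AddSubmonoid V} {p : V} :
    p ∈ amalgamCone K ↔ ∃ f : T →₀ V, (∀ t, f t ∈ K t) ∧ familySum T V f = p := Iff.rfl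

theorem le_amalgamCone (K : T → AddSubmonoid V) (t : T) : K t ≤ amalgamCone K := by
  classical
  intro p hp
  refine mem_amalgamCone.2 ⟨Finsupp.single t p, fun s => ?_, familySum_single t p⟩
  rw [Finsupp.single_apply]
  split_ifs with h
  · exact h ▸ hp
  · exact (K s).zero_mem

variable {u : V} {C : AddSubmonoid V} {K : T → AddSubmonoid V} {W : AddSubgroup V}

theorem mem_of_mem_amalgamCone (hKW : ∀ t, ∀ p ∈ K t, p ∈ W → p ∈ C)
    (hind : ∀ f : T →₀ V, (∀ t, f t ∈ K t) → familySum T V f ∈ W → ∀ t, f t ∈ W)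
    {p : V} (hp : p ∈ amalgamCone K) (hpW : p ∈ W) : p ∈ C := by
  obtain ⟨f, hf, rfl⟩ := mem_amalgamCone.1 hp
  rw [familySum_eq_sum]
  exact C.sum_mem fun t _ => hKW t _ (hf t) (hind f hf hpW t)

/-- By the independence `hind`, a relation between elements of different `K t` takes place term by
term in `W`, hence in `C`, which is pointed. -/
theorem isSimpleCone_amalgamCone [Nonempty T] (hC : IsSimpleCone u C)
    (hK : ∀ t, IsSimpleCone u (K t)) (hKW : ∀ t, ∀ p ∈ K t, p ∈ W → p ∈ C)
    (hind : ∀ f : T →₀ V, (∀ t, f t ∈ K t) → familySum T V f ∈ W → ∀ t, f t ∈ W) :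
    IsSimpleCone u (amalgamCone K) := by
  classical
  have hle := le_amalgamCone K
  refine ⟨hle (Classical.arbitrary T) (hK _).unit_mem, hC.unit_ne_zero, ?_, ?_, ?_⟩
  · intro p hp hp'
    obtain ⟨f, hf, rfl⟩ := mem_amalgamCone.1 hp
    obtain ⟨g, hg, hfg⟩ := mem_amalgamCone.1 hp'
    have hmem : ∀ t, (f + g) t ∈ K t := fun t => (K t).add_mem (hf t) (hg t)
    have hsum : familySum T V (f + g) = 0 := by rw [map_add, hfg, add_neg_cancel]
    have hW := hind (f + g) hmem (hsum ▸ W.zero_mem)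
    rw [familySum_eq_sum] at hsum
    have h0 := hC.eq_zero_of_sum_eq_zero _ _ (fun t _ => hKW t _ (hmem t) (hW t)) hsum
    have hf0 : f = 0 := by
      ext t
      refine (hK t).eq_zero_of_add_eq_zero (hf t) (hg t) ?_
      by_cases ht : t ∈ (f + g).support
      · exact h0 t ht
      · exact Finsupp.notMem_support_iff.1 ht
    rw [hf0, map_zero]
  · intro p hp hne
    obtain ⟨f, hf, rfl⟩ := mem_amalgamCone.1 hp
    obtain ⟨t, ht⟩ : ∃ t, f t ≠ 0 := by
      by_contra! h
      exact hne (by rw [show f = 0 from Finsupp.ext h, map_zero])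
    obtain ⟨n, hn⟩ := (hK t).dominates (f t) (hf t) ht
    refine ⟨n, ?_⟩
    have hdecomp : familySum T V f = f t + familySum T V (f.erase t) := by
      rw [← familySum_single t (f t), ← map_add, Finsupp.single_add_erase]
    have herase : familySum T V (f.erase t) ∈ amalgamCone K := by
      refine mem_amalgamCone.2 ⟨_, fun s => ?_, rfl⟩
      rw [Finsupp.erase_apply]
      split_ifs
      · exact (K s).zero_mem
      · exact hf s
    rw [hdecomp, nsmul_add, add_sub_right_comm]
    exact AddSubmonoid.add_mem _ (hle t hn) (AddSubmonoid.nsmul_mem _ herase n)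
  · intro p hp
    obtain ⟨f, hf, rfl⟩ := mem_amalgamCone.1 hp
    choose n hn using fun t => (hK t).bounded (f t) (hf t)
    refine ⟨∑ t ∈ f.support, n t, ?_⟩
    rw [familySum_eq_sum, Finset.sum_smul, ← Finset.sum_sub_distrib]
    exact AddSubmonoid.sum_mem _ fun t _ => hle t (hn t)

end Amalgam

/-! ### Solving a single problem -/

section Step

/-- `C'` is a simple cone in `U` that induces the cone `C` on `W`. -/
structure IsSimpleExtension (u : V) (W : AddSubgroup V) (C : AddSubmonoid V) (U : AddSubgroup V)
    (C' : AddSubmonoid V) : Prop where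
  isSimpleCone : IsSimpleCone u C'
  le : C ≤ C'
  subset : ∀ p ∈ C', p ∈ U
  restrict : ∀ p ∈ C', p ∈ W → p ∈ C

variable {u : V} {C : AddSubmonoid V} {W : AddSubgroup V}

theorem IsSimpleCone.isSimpleExtension_self (hC : IsSimpleCone u C) (hCW : ∀ p ∈ C, p ∈ W)
    {U : AddSubgroup V} (hWU : W ≤ U) : IsSimpleExtension u W C U C :=
  ⟨hC, le_rfl, fun p hp => hWU (hCW p hp), fun _ hp _ => hp⟩

/-- By `hW`, any multiple of `b` lying in `W` is a multiple of `a`, so making `b` positive forces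
nothing new on `W`. -/
theorem exists_isSimpleExtension_nsmul_eq (hC : IsSimpleCone u C) (hCW : ∀ p ∈ C, p ∈ W)
    {n : ℕ} (hn : 0 < n) {a b : V} (ha : a ∈ C) (hb : n • b = a)
    (hW : ∀ m : ℕ, m • b ∈ W → n ∣ m) {U : AddSubgroup V} (hWU : W ≤ U) (hbU : b ∈ U) :
    ∃ C', IsSimpleExtension u W C U C' ∧ ∃ b' ∈ C', n • b' = a := by
  by_cases ha0 : a = 0
  · exact ⟨C, hC.isSimpleExtension_self hCW hWU, 0, C.zero_mem, by rw [nsmul_zero, ha0]⟩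
  obtain ⟨M, hM⟩ := hC.dominates a ha ha0
  let φ : ℕ →+ V := multiplesHom V b
  let ℓ : ℕ →+ ℕ := AddMonoidHom.id ℕ
  have hφ_apply : ∀ m : ℕ, φ m = m • b := fun m => rfl
  have hℓ : ∀ m, ℓ m = 0 → m = 0 := fun m h => h
  have hφ : ∀ m k : ℕ, φ m ∈ W → n * (2 * M) * k < ℓ m →
      φ m - k • u ∈ C ∧ φ m - k • u ≠ 0 := by
    intro m k hm hk
    obtain ⟨q, rfl⟩ := hW m hm
    have hk : n * (2 * M) * k < n * q := hk
    rw [mul_assoc, Nat.mul_lt_mul_left hn] at hk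
    rw [hφ_apply, mul_comm n q, mul_nsmul', hb]
    rcases Nat.eq_zero_or_pos k with rfl | hk0
    · rw [zero_nsmul, sub_zero]
      exact ⟨C.nsmul_mem ha q, hC.nsmul_ne_zero ha ha0 (by omega)⟩
    -- As `k ≥ 1`, `2 * M * k < q` gives `M * (k + 1) ≤ q`. The spare `u` makes the difference
    -- nonzero.
    · have h1 : q • a - (k + 1) • u ∈ C :=
        IsSimpleCone.nsmul_sub_nsmul_mem ha hM (by nlinarith)
      have h2 : q • a - k • u = u + (q • a - (k + 1) • u) := by
        rw [add_nsmul, one_nsmul]; abel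
      rw [h2]
      exact ⟨C.add_mem hC.unit_mem h1, hC.add_ne_zero hC.unit_mem h1 hC.unit_ne_zero⟩
  refine ⟨extendCone u C φ ℓ (n * (2 * M)), ⟨isSimpleCone_extendCone hC hCW hℓ hφ ?_,
    le_extendCone _ _ _ _ _, ?_, fun p => mem_of_mem_extendCone hC hCW hφ⟩, b, ?_, hb⟩
  · intro m
    refine ⟨(n - 1) * m, ?_⟩
    have : φ m + φ ((n - 1) * m) = m • a := by
      rw [← map_add, hφ_apply, ← hb, ← mul_nsmul']
      congr 1
      obtain ⟨r, rfl⟩ := Nat.exists_eq_succ_of_ne_zero hn.ne'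
      rw [Nat.succ_sub_one, Nat.succ_eq_add_one]; ring
    rw [this]
    exact C.nsmul_mem ha m
  · rintro _ ⟨g, hg, m, k, -, rfl⟩
    exact U.sub_mem (U.add_mem (hWU (hCW g hg)) (U.nsmul_mem hbU m))
      (U.nsmul_mem (hWU (hCW u hC.unit_mem)) k)
  · have := apply_mem_extendCone u C φ (n * (2 * M)) hℓ 1
    rwa [hφ_apply, one_nsmul] at this

/-- A two by two transportation problem: the corner `m₀₀` is taken as large as possible. -/
theorem exists_matrix_of_add_eq_add {a₀ a₁ b₀ b₁ : ℕ} (h : a₀ + a₁ = b₀ + b₁) :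
    ∃ m₀₀ m₀₁ m₁₀ m₁₁ : ℕ, a₀ = m₀₀ + m₀₁ ∧ a₁ = m₁₀ + m₁₁ ∧ b₀ = m₀₀ + m₁₀ ∧
      b₁ = m₀₁ + m₁₁ :=
  ⟨min a₀ b₀, a₀ - b₀, b₀ - a₀, a₁ - (b₀ - a₀), by omega, by omega, by omega, by omega⟩

/-- Since `z` is free over `W`, a combination of the `z - xᵢ` and `yⱼ - z` lies in `W` only if `z`
cancels. Pairing the terms then rewrites it as a sum of the old elements `yⱼ - xᵢ`. -/
theorem exists_isSimpleExtension_interpolant (hC : IsSimpleCone u C) (hCW : ∀ p ∈ C, p ∈ W)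
    {x₀ x₁ y₀ y₁ z : V} (hx₀ : x₀ ∈ W) (hx₁ : x₁ ∈ W) (hy₀ : y₀ ∈ W) (hy₁ : y₁ ∈ W)
    (h₀₀ : y₀ - x₀ ∈ C) (h₀₁ : y₁ - x₀ ∈ C) (h₁₀ : y₀ - x₁ ∈ C) (h₁₁ : y₁ - x₁ ∈ C)
    (hz : ∀ m : ℤ, m • z ∈ W → m = 0) {U : AddSubgroup V} (hWU : W ≤ U) (hzU : z ∈ U) :
    ∃ C', IsSimpleExtension u W C U C' ∧
      ∃ z', z' - x₀ ∈ C' ∧ z' - x₁ ∈ C' ∧ y₀ - z' ∈ C' ∧ y₁ - z' ∈ C' := by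
  have hself := hC.isSimpleExtension_self hCW hWU
  -- If some `yⱼ = xᵢ`, that element interpolates. Otherwise all four differences are nonzero and so
  -- dominate `u`.
  by_cases n₀₀ : y₀ - x₀ = 0
  · rw [sub_eq_zero] at n₀₀
    exact ⟨C, hself, y₀, h₀₀, h₁₀, by simp, n₀₀ ▸ h₀₁⟩
  by_cases n₀₁ : y₁ - x₀ = 0
  · rw [sub_eq_zero] at n₀₁
    exact ⟨C, hself, y₁, h₀₁, h₁₁, n₀₁ ▸ h₀₀, by simp⟩
  by_cases n₁₀ : y₀ - x₁ = 0
  · rw [sub_eq_zero] at n₁₀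
    exact ⟨C, hself, y₀, h₀₀, h₁₀, by simp, n₁₀ ▸ h₁₁⟩
  by_cases n₁₁ : y₁ - x₁ = 0
  · rw [sub_eq_zero] at n₁₁
    exact ⟨C, hself, y₁, h₀₁, h₁₁, n₁₁ ▸ h₁₀, by simp⟩
  obtain ⟨M₀₀, hM₀₀⟩ := hC.dominates _ h₀₀ n₀₀
  obtain ⟨M₀₁, hM₀₁⟩ := hC.dominates _ h₀₁ n₀₁
  obtain ⟨M₁₀, hM₁₀⟩ := hC.dominates _ h₁₀ n₁₀
  obtain ⟨M₁₁, hM₁₁⟩ := hC.dominates _ h₁₁ n₁₁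
  obtain ⟨M, hM, l₀₀, l₀₁, l₁₀, l₁₁⟩ :
      ∃ M, 0 < M ∧ M₀₀ ≤ M ∧ M₀₁ ≤ M ∧ M₁₀ ≤ M ∧ M₁₁ ≤ M :=
    ⟨M₀₀ + M₀₁ + M₁₀ + M₁₁ + 1, by omega, by omega, by omega, by omega, by omega⟩
  replace hM₀₀ := IsSimpleCone.nsmul_sub_mem_of_le h₀₀ hM₀₀ l₀₀
  replace hM₀₁ := IsSimpleCone.nsmul_sub_mem_of_le h₀₁ hM₀₁ l₀₁
  replace hM₁₀ := IsSimpleCone.nsmul_sub_mem_of_le h₁₀ hM₁₀ l₁₀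
  replace hM₁₁ := IsSimpleCone.nsmul_sub_mem_of_le h₁₁ hM₁₁ l₁₁
  let φ : (ℕ × ℕ) × (ℕ × ℕ) →+ V :=
    ((multiplesHom V (z - x₀)).coprod (multiplesHom V (z - x₁))).coprod
      ((multiplesHom V (y₀ - z)).coprod (multiplesHom V (y₁ - z)))
  let ℓ : (ℕ × ℕ) × (ℕ × ℕ) →+ ℕ :=
    ((AddMonoidHom.id ℕ).coprod (AddMonoidHom.id ℕ)).coprod
      ((AddMonoidHom.id ℕ).coprod (AddMonoidHom.id ℕ))
  have hφ_apply : ∀ a₀ a₁ b₀ b₁ : ℕ, φ ((a₀, a₁), (b₀, b₁)) =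
      (a₀ • (z - x₀) + a₁ • (z - x₁)) + (b₀ • (y₀ - z) + b₁ • (y₁ - z)) :=
    fun _ _ _ _ => rfl
  have hℓ_apply : ∀ a₀ a₁ b₀ b₁ : ℕ, ℓ ((a₀, a₁), (b₀, b₁)) = (a₀ + a₁) + (b₀ + b₁) :=
    fun _ _ _ _ => rfl
  have hℓ : ∀ a, ℓ a = 0 → a = 0 := by
    rintro ⟨⟨a₀, a₁⟩, ⟨b₀, b₁⟩⟩ h
    rw [hℓ_apply] at h
    simp only [Prod.mk_eq_zero]
    omega
  have hφ : ∀ a (k : ℕ), φ a ∈ W → 20 * M * k < ℓ a →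
      φ a - k • u ∈ C ∧ φ a - k • u ≠ 0 := by
    rintro ⟨⟨a₀, a₁⟩, ⟨b₀, b₁⟩⟩ k hW hk
    rw [hφ_apply] at hW
    rw [hℓ_apply] at hk
    have hab : a₀ + a₁ = b₀ + b₁ := by
      have : ((a₀ + a₁ : ℤ) - (b₀ + b₁)) • z ∈ W := by
        have h1 := W.add_mem hW (W.sub_mem
          (W.add_mem (W.nsmul_mem hx₀ a₀) (W.nsmul_mem hx₁ a₁))
          (W.add_mem (W.nsmul_mem hy₀ b₀) (W.nsmul_mem hy₁ b₁)))
        convert h1 using 1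
        module
      have := hz _ this
      omega
    obtain ⟨m₀₀, m₀₁, m₁₀, m₁₁, rfl, rfl, rfl, rfl⟩ := exists_matrix_of_add_eq_add hab
    rw [hφ_apply]
    have hsum : (m₀₀ + m₀₁) • (z - x₀) + (m₁₀ + m₁₁) • (z - x₁) +
        ((m₀₀ + m₁₀) • (y₀ - z) + (m₀₁ + m₁₁) • (y₁ - z)) =
        m₀₀ • (y₀ - x₀) + m₀₁ • (y₁ - x₀) + m₁₀ • (y₀ - x₁) + m₁₁ • (y₁ - x₁) := by
      module
    rw [hsum]
    rcases Nat.eq_zero_or_pos k with rfl | hk0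
    · rw [zero_nsmul, sub_zero]
      have c₀₀ := C.nsmul_mem h₀₀ m₀₀
      have c₀₁ := C.nsmul_mem h₀₁ m₀₁
      have c₁₀ := C.nsmul_mem h₁₀ m₁₀
      have c₁₁ := C.nsmul_mem h₁₁ m₁₁
      refine ⟨C.add_mem (C.add_mem (C.add_mem c₀₀ c₀₁) c₁₀) c₁₁, fun h => ?_⟩
      have e₁₁ := hC.eq_zero_of_add_eq_zero c₁₁ (C.add_mem (C.add_mem c₀₀ c₀₁) c₁₀)
        (by rw [← h]; abel)
      have e₁₀ := hC.eq_zero_of_add_eq_zero c₁₀ (C.add_mem (C.add_mem c₀₀ c₀₁) c₁₁)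
        (by rw [← h]; abel)
      have e₀₁ := hC.eq_zero_of_add_eq_zero c₀₁ (C.add_mem (C.add_mem c₀₀ c₁₀) c₁₁)
        (by rw [← h]; abel)
      have e₀₀ := hC.eq_zero_of_add_eq_zero c₀₀ (C.add_mem (C.add_mem c₀₁ c₁₀) c₁₁)
        (by rw [← h]; abel)
      have z₁₁ := not_imp_not.1 (hC.nsmul_ne_zero h₁₁ n₁₁) e₁₁
      have z₁₀ := not_imp_not.1 (hC.nsmul_ne_zero h₁₀ n₁₀) e₁₀
      have z₀₁ := not_imp_not.1 (hC.nsmul_ne_zero h₀₁ n₀₁) e₀₁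
      have z₀₀ := not_imp_not.1 (hC.nsmul_ne_zero h₀₀ n₀₀) e₀₀
      omega
    · have r₀₀ := IsSimpleCone.nsmul_sub_nsmul_mem h₀₀ hM₀₀ (Nat.mul_div_le m₀₀ M)
      have r₀₁ := IsSimpleCone.nsmul_sub_nsmul_mem h₀₁ hM₀₁ (Nat.mul_div_le m₀₁ M)
      have r₁₀ := IsSimpleCone.nsmul_sub_nsmul_mem h₁₀ hM₁₀ (Nat.mul_div_le m₁₀ M)
      have r₁₁ := IsSimpleCone.nsmul_sub_nsmul_mem h₁₁ hM₁₁ (Nat.mul_div_le m₁₁ M)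
      have s₀₀ := Nat.lt_mul_div_succ m₀₀ hM
      have s₀₁ := Nat.lt_mul_div_succ m₀₁ hM
      have s₁₀ := Nat.lt_mul_div_succ m₁₀ hM
      have s₁₁ := Nat.lt_mul_div_succ m₁₁ hM
      generalize m₀₀ / M = k₀₀ at *
      generalize m₀₁ / M = k₀₁ at *
      generalize m₁₀ / M = k₁₀ at *
      generalize m₁₁ / M = k₁₁ at *
      -- The weight is twice the sum of the `mᵢⱼ`, so that sum exceeds `10 * M * k`. Rounding down
      -- the four quotients by `M` loses less than 4 in all, and `10 * k - 4 ≥ k` for `k ≥ 1`.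
      have hlt : k < k₀₀ + k₀₁ + k₁₀ + k₁₁ := by
        have : M * (10 * k) < M * (k₀₀ + k₀₁ + k₁₀ + k₁₁ + 4) := by nlinarith
        have := lt_of_mul_lt_mul_left this (Nat.zero_le M)
        omega
      obtain ⟨r, hr⟩ := Nat.exists_eq_add_of_lt hlt
      have hC' := C.add_mem (C.add_mem (C.add_mem (C.add_mem r₀₀ r₀₁) r₁₀) r₁₁)
        (C.nsmul_mem hC.unit_mem r)
      have h2 : m₀₀ • (y₀ - x₀) + m₀₁ • (y₁ - x₀) + m₁₀ • (y₀ - x₁) + m₁₁ • (y₁ - x₁) - k • u =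
          u + (m₀₀ • (y₀ - x₀) - k₀₀ • u + (m₀₁ • (y₁ - x₀) - k₀₁ • u) +
            (m₁₀ • (y₀ - x₁) - k₁₀ • u) + (m₁₁ • (y₁ - x₁) - k₁₁ • u) + r • u) := by
        have h3 : (k₀₀ + k₀₁ + k₁₀ + k₁₁) • u = (k + r + 1) • u := by rw [hr]
        simp only [add_nsmul, one_nsmul] at h3
        rw [← sub_eq_zero] at h3 ⊢
        rw [← h3]
        abel
      rw [h2]
      exact ⟨C.add_mem hC.unit_mem hC', hC.add_ne_zero hC.unit_mem hC' hC.unit_ne_zero⟩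
  refine ⟨extendCone u C φ ℓ (20 * M), ⟨isSimpleCone_extendCone hC hCW hℓ hφ ?_,
    le_extendCone _ _ _ _ _, ?_, fun p => mem_of_mem_extendCone hC hCW hφ⟩, z, ?_, ?_, ?_, ?_⟩
  · rintro ⟨⟨a₀, a₁⟩, ⟨b₀, b₁⟩⟩
    refine ⟨((b₀, b₁), (a₀, a₁)), ?_⟩
    have : φ ((a₀, a₁), (b₀, b₁)) + φ ((b₀, b₁), (a₀, a₁)) =
        (a₀ + b₀) • (y₀ - x₀) + (a₁ + b₁) • (y₁ - x₁) := by
      rw [hφ_apply, hφ_apply]; module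
    rw [this]
    exact C.add_mem (C.nsmul_mem h₀₀ _) (C.nsmul_mem h₁₁ _)
  · rintro _ ⟨g, hg, ⟨⟨a₀, a₁⟩, ⟨b₀, b₁⟩⟩, k, -, rfl⟩
    rw [hφ_apply]
    exact U.sub_mem (U.add_mem (hWU (hCW g hg)) (U.add_mem
      (U.add_mem (U.nsmul_mem (U.sub_mem hzU (hWU hx₀)) _)
        (U.nsmul_mem (U.sub_mem hzU (hWU hx₁)) _))
      (U.add_mem (U.nsmul_mem (U.sub_mem (hWU hy₀) hzU) _)
        (U.nsmul_mem (U.sub_mem (hWU hy₁) hzU) _))))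
      (U.nsmul_mem (hWU (hCW u hC.unit_mem)) k)
  · simpa [hφ_apply] using apply_mem_extendCone u C φ (20 * M) hℓ ((1, 0), (0, 0))
  · simpa [hφ_apply] using apply_mem_extendCone u C φ (20 * M) hℓ ((0, 1), (0, 0))
  · simpa [hφ_apply] using apply_mem_extendCone u C φ (20 * M) hℓ ((0, 0), (1, 0))
  · simpa [hφ_apply] using apply_mem_extendCone u C φ (20 * M) hℓ ((0, 0), (0, 1))

end Step

end SimpleCone

/-! ### The union of a chain of extensions -/

section Chain

variable {V : Type*} [AddCommGroup V]

/-- `C'` contains interpolants for all the interpolation problems in `W` with respect to `C`, and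
all the fractions of the elements of `C`. -/
structure SolvesProblems (W : Set V) (C C' : AddSubmonoid V) : Prop where
  interpolation : ∀ x₀ ∈ W, ∀ x₁ ∈ W, ∀ y₀ ∈ W, ∀ y₁ ∈ W, y₀ - x₀ ∈ C → y₁ - x₀ ∈ C →
    y₀ - x₁ ∈ C → y₁ - x₁ ∈ C →
    ∃ z, z - x₀ ∈ C' ∧ z - x₁ ∈ C' ∧ y₀ - z ∈ C' ∧ y₁ - z ∈ C'
  division : ∀ n : ℕ, 0 < n → ∀ a ∈ C, ∃ b ∈ C', n • b = a

/-- A problem involves finitely many elements and inequalities, so it is posed at some stage and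
solved at the next. -/
theorem exists_isSimpleCone_solvesProblems {u : V} {W : ℕ → AddSubgroup V} (hW : Monotone W)
    (hWtop : ∀ v, ∃ k, v ∈ W k)
    (hstep : ∀ k C, IsSimpleCone u C → (∀ p ∈ C, p ∈ W k) →
      ∃ C', IsSimpleExtension u (W k) C (W (k + 1)) C' ∧ SolvesProblems (W k : Set V) C C')
    {C₀ : AddSubmonoid V} (hC₀ : IsSimpleCone u C₀) (hC₀W : ∀ p ∈ C₀, p ∈ W 0) :
    ∃ C, IsSimpleCone u C ∧ C₀ ≤ C ∧ (∀ p ∈ C, p ∈ W 0 → p ∈ C₀) ∧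
      SolvesProblems Set.univ C C := by
  choose next hnext hsolve using hstep
  let S : ∀ k, {C : AddSubmonoid V // IsSimpleCone u C ∧ ∀ p ∈ C, p ∈ W k} := fun k =>
    Nat.rec ⟨C₀, hC₀, hC₀W⟩ (fun k C => ⟨next k C.1 C.2.1 C.2.2,
      (hnext k C.1 C.2.1 C.2.2).isSimpleCone, (hnext k C.1 C.2.1 C.2.2).subset⟩) k
  let K : ℕ → AddSubmonoid V := fun k => (S k).1
  have hK : ∀ k, IsSimpleCone u (K k) := fun k => (S k).2.1
  have hKW : ∀ k, ∀ p ∈ K k, p ∈ W k := fun k => (S k).2.2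
  have hext : ∀ k, IsSimpleExtension u (W k) (K k) (W (k + 1)) (K (k + 1)) :=
    fun k => hnext k _ _ _
  have hsolveK : ∀ k, SolvesProblems (W k : Set V) (K k) (K (k + 1)) := fun k => hsolve k _ _ _
  have hmono : Monotone K := monotone_nat_of_le_succ fun k => (hext k).le
  have hmem : ∀ {p}, p ∈ ⨆ k, K k ↔ ∃ k, p ∈ K k :=
    AddSubmonoid.mem_iSup_of_directed hmono.directed_le
  have hle : ∀ k, K k ≤ ⨆ k, K k := le_iSup K
  refine ⟨⨆ k, K k, ⟨hle 0 hC₀.unit_mem, hC₀.unit_ne_zero, ?_, ?_, ?_⟩, hle 0, ?_, ?_, ?_⟩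
  · intro p hp hp'
    obtain ⟨i, hi⟩ := hmem.1 hp
    obtain ⟨j, hj⟩ := hmem.1 hp'
    exact (hK (max i j)).pointed p (hmono (le_max_left i j) hi) (hmono (le_max_right i j) hj)
  · intro p hp hne
    obtain ⟨i, hi⟩ := hmem.1 hp
    obtain ⟨n, hn⟩ := (hK i).dominates p hi hne
    exact ⟨n, hle i hn⟩
  · intro p hp
    obtain ⟨i, hi⟩ := hmem.1 hp
    obtain ⟨n, hn⟩ := (hK i).bounded p hi
    exact ⟨n, hle i hn⟩
  · intro p hp hp0
    obtain ⟨i, hi⟩ := hmem.1 hp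
    induction i with
    | zero => exact hi
    | succ i ih => exact ih ((hext i).restrict p hi (hW (Nat.zero_le i) hp0))
  · intro x₀ _ x₁ _ y₀ _ y₁ _ h₀₀ h₀₁ h₁₀ h₁₁
    obtain ⟨i₁, h₁⟩ := hWtop x₀
    obtain ⟨i₂, h₂⟩ := hWtop x₁
    obtain ⟨i₃, h₃⟩ := hWtop y₀
    obtain ⟨i₄, h₄⟩ := hWtop y₁
    obtain ⟨i₅, h₅⟩ := hmem.1 h₀₀
    obtain ⟨i₆, h₆⟩ := hmem.1 h₀₁
    obtain ⟨i₇, h₇⟩ := hmem.1 h₁₀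
    obtain ⟨i₈, h₈⟩ := hmem.1 h₁₁
    obtain ⟨k, l₁, l₂, l₃, l₄, l₅, l₆, l₇, l₈⟩ : ∃ k, i₁ ≤ k ∧ i₂ ≤ k ∧ i₃ ≤ k ∧ i₄ ≤ k ∧
        i₅ ≤ k ∧ i₆ ≤ k ∧ i₇ ≤ k ∧ i₈ ≤ k :=
      ⟨i₁ + i₂ + i₃ + i₄ + i₅ + i₆ + i₇ + i₈, by omega⟩
    obtain ⟨z, z₁, z₂, z₃, z₄⟩ := (hsolveK k).interpolation x₀ (hW l₁ h₁) x₁ (hW l₂ h₂)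
      y₀ (hW l₃ h₃) y₁ (hW l₄ h₄) (hmono l₅ h₅) (hmono l₆ h₆) (hmono l₇ h₇) (hmono l₈ h₈)
    exact ⟨z, hle _ z₁, hle _ z₂, hle _ z₃, hle _ z₄⟩
  · intro n hn a ha
    obtain ⟨i, hi⟩ := hmem.1 ha
    obtain ⟨b, hb, hba⟩ := (hsolveK i).division n hn a hi
    exact ⟨b, hle _ hb, hba⟩

end Chain

/-! ### The ambient group and one stage of the construction -/

section Ambient

variable {D X F : Type*} [AddCommGroup D] [AddCommGroup F]

/-- The elements of `D × (ℕ × X →₀ F)` that only involve generators of level less than `k`. -/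
def level (D X F : Type*) [AddCommGroup D] [AddCommGroup F] (k : ℕ) :
    AddSubgroup (D × (ℕ × X →₀ F)) where
  carrier := {v | ∀ i x, k ≤ i → v.2 (i, x) = 0}
  zero_mem' := fun _ _ _ => rfl
  add_mem' := fun hv hw i x h => by simp [hv i x h, hw i x h]
  neg_mem' := fun hv i x h => by simp [hv i x h]

/-- The subgroup generated by `level D X F k` and the generators indexed by `(k, x)`. -/
def levelWith (D : Type*) {X : Type*} (F : Type*) [AddCommGroup D] [AddCommGroup F] (k : ℕ)
    (x : X) : AddSubgroup (D × (ℕ × X →₀ F)) where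
  carrier := {v | ∀ i y, k ≤ i → (i, y) ≠ (k, x) → v.2 (i, y) = 0}
  zero_mem' := fun _ _ _ _ => rfl
  add_mem' := fun hv hw i y h h' => by simp [hv i y h h', hw i y h h']
  neg_mem' := fun hv i y h h' => by simp [hv i y h h']

theorem level_mono : Monotone (level D X F) :=
  fun _ _ hjk _ hv i x h => hv i x (hjk.trans h)

theorem exists_mem_level (v : D × (ℕ × X →₀ F)) : ∃ k, v ∈ level D X F k := by
  refine ⟨v.2.support.sup Prod.fst + 1, fun i x h => ?_⟩
  by_contra hne
  have := Finset.le_sup (f := Prod.fst) (Finsupp.mem_support_iff.2 hne)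
  simp only at this
  omega

theorem level_le_levelWith (k : ℕ) (x : X) : level D X F k ≤ levelWith D F k x :=
  fun _ hv i y h _ => hv i y h

theorem levelWith_le_level_succ (k : ℕ) (x : X) : levelWith D F k x ≤ level D X F (k + 1) :=
  fun _ hv i y h => hv i y (by omega) (by rintro ⟨⟩; omega)

theorem single_mem_levelWith (k : ℕ) (x : X) (ω : F) :
    ((0, Finsupp.single (k, x) ω) : D × (ℕ × X →₀ F)) ∈ levelWith D F k x :=
  fun _ _ _ h => Finsupp.single_eq_of_ne h

/-- The coordinate `(k, τ t)` vanishes on all terms but the one indexed by `t`, so in a sum of level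
`k` it vanishes on that term too. -/
theorem mem_level_of_familySum_mem {T : Type*} {τ : T → X} (hτ : Function.Injective τ) {k : ℕ}
    (f : T →₀ D × (ℕ × X →₀ F)) (hf : ∀ t, f t ∈ levelWith D F k (τ t))
    (hs : familySum T _ f ∈ level D X F k) (t : T) : f t ∈ level D X F k := by
  intro i y hi
  by_cases h : (i, y) = (k, τ t)
  · let π : D × (ℕ × X →₀ F) →+ F :=
      (Finsupp.applyAddHom (k, τ t)).comp (AddMonoidHom.snd D (ℕ × X →₀ F))
    have hπ : ∀ v, π v = v.2 (k, τ t) := fun _ => rfl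
    have h1 : π (familySum T _ f) = 0 := hs k _ le_rfl
    rw [familySum_eq_sum, map_sum, Finset.sum_eq_single t] at h1
    · rw [h]; exact h1
    · intro s _ hst
      exact hf s k (τ t) le_rfl fun e => hst (hτ (Prod.mk.inj e).2.symm)
    · intro ht
      rw [Finsupp.notMem_support_iff.1 ht, map_zero]
  · exact hf t i y hi h

theorem exists_mem_level_nsmul_eq (hD : ∀ n : ℕ, 0 < n → ∀ a : D, ∃ b, n • b = a)
    (hF : ∀ n : ℕ, 0 < n → ∀ a : F, ∃ b, n • b = a) {n : ℕ} (hn : 0 < n) {k : ℕ}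
    {v : D × (ℕ × X →₀ F)} (hv : v ∈ level D X F k) : ∃ w ∈ level D X F k, n • w = v := by
  classical
  obtain ⟨d, hd⟩ := hD n hn v.1
  choose q hq using hF n hn
  let q' : F → F := fun x => if x = 0 then 0 else q x
  have hq'0 : q' 0 = 0 := if_pos rfl
  have hq' : ∀ x, n • q' x = x := by
    intro x
    by_cases hx : x = 0
    · simp [q', hx]
    · simp [q', hx, hq]
  refine ⟨(d, v.2.mapRange q' hq'0), fun i x h => ?_, Prod.ext hd (Finsupp.ext fun i => ?_)⟩
  · simp [hv i x h, hq'0]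
  · simp [hq']

theorem exists_isSimpleExtension_solvesProblems
    (hD : ∀ n : ℕ, 0 < n → ∀ a : D, ∃ b, n • b = a)
    (hF : ∀ n : ℕ, 0 < n → ∀ a : F, ∃ b, n • b = a)
    (hfree : ∃ ω : F, ∀ m : ℤ, m • ω = 0 → m = 0)
    (htors : ∀ n : ℕ, 0 < n → ∃ ε : F, addOrderOf ε = n)
    {τ : ((D × (ℕ × X →₀ F)) × (D × (ℕ × X →₀ F)) × (D × (ℕ × X →₀ F)) ×
      (D × (ℕ × X →₀ F))) × ℕ → X} (hτ : Function.Injective τ)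
    {u : D × (ℕ × X →₀ F)} (k : ℕ) (C : AddSubmonoid (D × (ℕ × X →₀ F)))
    (hC : IsSimpleCone u C) (hCW : ∀ p ∈ C, p ∈ level D X F k) :
    ∃ C', IsSimpleExtension u (level D X F k) C (level D X F (k + 1)) C' ∧
      SolvesProblems (level D X F k : Set (D × (ℕ × X →₀ F))) C C' := by
  -- `t.2 = 0` encodes interpolation between the four entries, `t.2 > 0` division of the first entry
  -- by `t.2`. If the hypotheses of the problem fail, `C` is kept.
  have hsolve : ∀ t, ∃ C',
      IsSimpleExtension u (level D X F k) C (levelWith D F k (τ t)) C' ∧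
      (t.1.1 ∈ level D X F k → t.1.2.1 ∈ level D X F k → t.1.2.2.1 ∈ level D X F k →
        t.1.2.2.2 ∈ level D X F k → t.1.2.2.1 - t.1.1 ∈ C → t.1.2.2.2 - t.1.1 ∈ C →
        t.1.2.2.1 - t.1.2.1 ∈ C → t.1.2.2.2 - t.1.2.1 ∈ C → t.2 = 0 →
        ∃ z, z - t.1.1 ∈ C' ∧ z - t.1.2.1 ∈ C' ∧ t.1.2.2.1 - z ∈ C' ∧ t.1.2.2.2 - z ∈ C') ∧
      (0 < t.2 → t.1.1 ∈ C → ∃ b ∈ C', t.2 • b = t.1.1) := by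
    rintro ⟨⟨x₀, x₁, y₀, y₁⟩, n⟩
    have hself := hC.isSimpleExtension_self hCW (level_le_levelWith k
      (τ ⟨⟨x₀, x₁, y₀, y₁⟩, n⟩))
    generalize τ ⟨⟨x₀, x₁, y₀, y₁⟩, n⟩ = x at *
    dsimp only
    rcases Nat.eq_zero_or_pos n with rfl | hn
    · by_cases h : x₀ ∈ level D X F k ∧ x₁ ∈ level D X F k ∧ y₀ ∈ level D X F k ∧
          y₁ ∈ level D X F k ∧ y₀ - x₀ ∈ C ∧ y₁ - x₀ ∈ C ∧ y₀ - x₁ ∈ C ∧ y₁ - x₁ ∈ C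
      · obtain ⟨h₁, h₂, h₃, h₄, h₅, h₆, h₇, h₈⟩ := h
        obtain ⟨ω, hω⟩ := hfree
        obtain ⟨C', hC', hz⟩ := exists_isSimpleExtension_interpolant hC hCW h₁ h₂ h₃ h₄
          h₅ h₆ h₇ h₈ (z := (0, Finsupp.single (k, x) ω)) (fun m hm => hω m (by
            simpa using hm k x le_rfl)) (level_le_levelWith k x) (single_mem_levelWith k x ω)
        exact ⟨C', hC', fun _ _ _ _ _ _ _ _ _ => hz, fun h => absurd h (lt_irrefl 0)⟩
      · exact ⟨C, hself, fun h₁ h₂ h₃ h₄ h₅ h₆ h₇ h₈ _ =>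
          absurd ⟨h₁, h₂, h₃, h₄, h₅, h₆, h₇, h₈⟩ h, fun h => absurd h (lt_irrefl 0)⟩
    · by_cases h : x₀ ∈ C
      · obtain ⟨b, hb, hbx⟩ := exists_mem_level_nsmul_eq hD hF hn (hCW x₀ h)
        obtain ⟨ε, hε⟩ := htors n hn
        have hε0 : n • ε = 0 := by rw [← hε]; exact addOrderOf_nsmul_eq_zero ε
        -- A root `b` in level `k` need not be compatible with the order already there. Adding `ε`,
        -- of order exactly `n`, keeps it a root and lets a multiple return to level `k` only when
        -- `n` divides the factor.
        obtain ⟨C', hC', hz⟩ := exists_isSimpleExtension_nsmul_eq hC hCW hn h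
          (b := b + (0, Finsupp.single (k, x) ε))
          (by rw [nsmul_add, hbx]; simp [hε0])
          (fun m hm => by
            have h1 := hm k x le_rfl
            rw [← hε]
            apply addOrderOf_dvd_of_nsmul_eq_zero
            simpa [hb k x le_rfl] using h1)
          (level_le_levelWith k x)
          (AddSubgroup.add_mem _ (level_le_levelWith k x hb) (single_mem_levelWith k x ε))
        exact ⟨C', hC', fun _ _ _ _ _ _ _ _ h0 => absurd h0 hn.ne', fun _ _ => hz⟩
      · exact ⟨C, hself, fun _ _ _ _ _ _ _ _ h0 => absurd h0 hn.ne', fun _ h' => absurd h' h⟩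
  choose K hK hint hdiv using hsolve
  have hKW : ∀ t, ∀ p ∈ K t, p ∈ level D X F k → p ∈ C := fun t => (hK t).restrict
  have hind : ∀ f, (∀ t, f t ∈ K t) → familySum _ _ f ∈ level D X F k →
      ∀ t, f t ∈ level D X F k := fun f hf hs =>
    mem_level_of_familySum_mem hτ f (fun t => (hK t).subset _ (hf t)) hs
  have hle := le_amalgamCone K
  refine ⟨amalgamCone K, ⟨isSimpleCone_amalgamCone hC (fun t => (hK t).isSimpleCone) hKW hind,
    (hK (Classical.arbitrary _)).le.trans (hle _), ?_,
    fun p => mem_of_mem_amalgamCone hKW hind⟩, ?_, ?_⟩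
  · rintro p hp
    obtain ⟨f, hf, rfl⟩ := mem_amalgamCone.1 hp
    rw [familySum_eq_sum]
    exact AddSubgroup.sum_mem _ fun t _ =>
      levelWith_le_level_succ k (τ t) ((hK t).subset _ (hf t))
  · intro x₀ h₁ x₁ h₂ y₀ h₃ y₁ h₄ h₅ h₆ h₇ h₈
    obtain ⟨z, z₁, z₂, z₃, z₄⟩ := hint ⟨⟨x₀, x₁, y₀, y₁⟩, 0⟩ h₁ h₂ h₃ h₄ h₅ h₆ h₇ h₈ rfl
    exact ⟨z, hle _ z₁, hle _ z₂, hle _ z₃, hle _ z₄⟩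
  · intro n hn a ha
    obtain ⟨b, hb, hba⟩ := hdiv ⟨⟨a, 0, 0, 0⟩, n⟩ hn ha
    exact ⟨b, hle _ hb, hba⟩

end Ambient

/-! ### Counting problems -/

section Cardinality

open Cardinal

theorem exists_injective_of_countable {D X : Type u} {F : Type} [AddCommGroup D] [AddCommGroup F]
    [Countable F] [Nontrivial F] [Infinite X] (hDX : #D ≤ #X) :
    ∃ τ : ((D × (ℕ × X →₀ F)) × (D × (ℕ × X →₀ F)) × (D × (ℕ × X →₀ F)) ×
      (D × (ℕ × X →₀ F))) × ℕ → X, Function.Injective τ := by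
  have hX : ℵ₀ ≤ #X := aleph0_le_mk X
  have hmul : ∀ a b : Cardinal.{u}, a ≤ #X → b ≤ #X → a * b ≤ #X := fun a b ha hb =>
    (mul_le_mul' ha hb).trans_eq (mul_eq_self hX)
  have hN : lift.{u} #ℕ ≤ #X := by simp
  have hf : #(ℕ × X →₀ F) ≤ #X := by
    rw [mk_finsupp_lift_of_infinite]
    refine max_le ?_ ?_
    · rw [lift_uzero, mk_prod, lift_uzero]
      exact hmul _ _ hN le_rfl
    · exact (lift_le_aleph0.2 (mk_le_aleph0 (α := F))).trans hX
  have hV : #(D × (ℕ × X →₀ F)) ≤ #X := by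
    rw [mk_prod, lift_id, lift_id]
    exact hmul _ _ hDX hf
  suffices h : #(((D × (ℕ × X →₀ F)) × (D × (ℕ × X →₀ F)) × (D × (ℕ × X →₀ F)) ×
      (D × (ℕ × X →₀ F))) × ℕ) ≤ #X by
    obtain ⟨e⟩ := h
    exact ⟨e, e.injective⟩
  rw [mk_prod, lift_uzero]
  refine hmul _ _ ?_ hN
  simp only [mk_prod, lift_id] at hV ⊢
  exact hmul _ _ hV (hmul _ _ hV (hmul _ _ hV hV))

end Cardinality

/-! ### The ordered group generated by a cone -/

section Order

variable {V : Type u} [AddCommGroup V]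

/-- The group generated by a submonoid, to be ordered by this submonoid. -/
abbrev ConeGroup (C : AddSubmonoid V) : Type u := AddSubgroup.closure (C : Set V)

variable {u : V} {C : AddSubmonoid V}

/-- The partial order whose positive cone is a given pointed submonoid. -/
abbrev ConeGroup.partialOrder (hC : ∀ p ∈ C, -p ∈ C → p = 0) : PartialOrder (ConeGroup C) where
  le x y := (y : V) - x ∈ C
  le_refl x := by simp
  le_trans x y z hxy hyz := by
    have := C.add_mem hyz hxy
    rwa [sub_add_sub_cancel] at this
  le_antisymm x y hxy hyx := by
    have := hC _ hxy (by rwa [neg_sub])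
    exact Subtype.ext (sub_eq_zero.1 this).symm

theorem IsSimpleCone.exists_bound (hC : IsSimpleCone u C) {x : V}
    (hx : x ∈ AddSubgroup.closure (C : Set V)) : ∃ n : ℕ, n • u - x ∈ C ∧ n • u + x ∈ C := by
  induction hx using AddSubgroup.closure_induction with
  | mem x hx =>
    obtain ⟨n, hn⟩ := hC.bounded x hx
    exact ⟨n, hn, C.add_mem (C.nsmul_mem hC.unit_mem n) hx⟩
  | zero => exact ⟨0, by simp, by simp⟩
  | add x y _ _ hx hy =>
    obtain ⟨n, h₁, h₂⟩ := hx
    obtain ⟨m, h₃, h₄⟩ := hy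
    refine ⟨n + m, ?_, ?_⟩
    · convert C.add_mem h₁ h₃ using 1; rw [add_nsmul]; abel
    · convert C.add_mem h₂ h₄ using 1; rw [add_nsmul]; abel
  | neg x _ hx =>
    obtain ⟨n, h₁, h₂⟩ := hx
    exact ⟨n, by rwa [sub_neg_eq_add], by rwa [← sub_eq_add_neg]⟩

/-- Multiples of `u` bound the subgroup generated by `C`, whence directedness. No solution is lost
in passing to it: `z = (z - x₀) + x₀`, and roots lie in `C`. -/
theorem IsSimpleCone.exists_simple_riesz_group (hC : IsSimpleCone u C)
    (hsolve : SolvesProblems Set.univ C C) :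
    ∃ (_ : PartialOrder (ConeGroup C)) (_ : IsOrderedAddMonoid (ConeGroup C)),
      IsSimplePOGroup (ConeGroup C) ∧ IsRieszGroup (ConeGroup C) ∧
      HasDivisiblePositiveCone (ConeGroup C) ∧
      ∀ x y : ConeGroup C, x ≤ y ↔ (y : V) - x ∈ C := by
  let _ := ConeGroup.partialOrder hC.pointed
  have hle : ∀ x y : ConeGroup C, x ≤ y ↔ (y : V) - x ∈ C := fun _ _ => Iff.rfl
  have hsub : ∀ p ∈ C, p ∈ AddSubgroup.closure (C : Set V) :=
    fun p hp => AddSubgroup.subset_closure hp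
  have : IsOrderedAddMonoid (ConeGroup C) :=
    { add_le_add_left := fun x y hxy z => by
        rw [hle] at hxy ⊢
        simpa using hxy }
  refine ⟨inferInstance, inferInstance, ?_, ⟨?_, ?_⟩, ?_, hle⟩
  · intro e he
    refine ⟨he.le, fun x => ?_⟩
    have heC : (e : V) ∈ C := by simpa [hle] using he.le
    have he0 : (e : V) ≠ 0 := fun h => he.ne' (Subtype.ext h)
    obtain ⟨m, hm⟩ := hC.dominates _ heC he0
    obtain ⟨n, hn, -⟩ := hC.exists_bound x.2
    refine ⟨n * m + 1, Nat.succ_pos _, ?_⟩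
    rw [hle]
    have : ((n * m + 1) • (e : V)) - x = n • (m • (e : V) - u) + (n • u - x) + e := by
      rw [add_nsmul, one_nsmul, mul_nsmul', nsmul_sub]; abel
    simp only [AddSubgroup.coe_nsmul]
    rw [this]
    exact C.add_mem (C.add_mem (C.nsmul_mem hm n) hn) heC
  · intro x y
    obtain ⟨n, hn, -⟩ := hC.exists_bound x.2
    obtain ⟨m, hm, -⟩ := hC.exists_bound y.2
    refine ⟨⟨(n + m) • u, AddSubgroup.nsmul_mem _ (hsub u hC.unit_mem) _⟩, ?_, ?_⟩
    · rw [hle]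
      convert C.add_mem hn (C.nsmul_mem hC.unit_mem m) using 1
      simp only [add_nsmul]; abel
    · rw [hle]
      convert C.add_mem hm (C.nsmul_mem hC.unit_mem n) using 1
      simp only [add_nsmul]; abel
  · intro x₀ x₁ y₀ y₁ h₀₀ h₀₁ h₁₀ h₁₁
    obtain ⟨z, z₁, z₂, z₃, z₄⟩ := hsolve.interpolation x₀ trivial x₁ trivial y₀ trivial y₁ trivial
      h₀₀ h₀₁ h₁₀ h₁₁
    have hz : z ∈ AddSubgroup.closure (C : Set V) := by
      simpa using AddSubgroup.add_mem _ (hsub _ z₁) x₀.2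
    exact ⟨⟨z, hz⟩, z₁, z₂, z₃, z₄⟩
  · intro n hn a ha
    have haC : (a : V) ∈ C := by simpa [hle] using ha
    obtain ⟨b, hb, hba⟩ := hsolve.division n hn a haC
    exact ⟨⟨b, hsub b hb⟩, by simpa [hle] using hb, Subtype.ext hba⟩

end Order

/-! ### Embedding a simple group -/

section Embedding

/-- Rational-circle-valued functions on the character group: a divisible group containing `G`. -/
abbrev DivisibleEnvelope (G : Type u) [AddCommGroup G] : Type u :=
  CharacterModule G → AddCircle (1 : ℚ)

/-- The evaluation map of a group into a divisible group. -/
def toDivisibleEnvelope (G : Type u) [AddCommGroup G] : G →+ DivisibleEnvelope G where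
  toFun g c := c g
  map_zero' := funext fun c => map_zero c
  map_add' x y := funext fun c => map_add c x y

theorem toDivisibleEnvelope_injective (G : Type u) [AddCommGroup G] :
    Function.Injective (toDivisibleEnvelope G) := by
  rw [injective_iff_map_eq_zero]
  exact fun g hg => CharacterModule.eq_zero_of_character_apply fun c => congrFun hg c

theorem exists_nsmul_eq_addCircle {n : ℕ} (hn : 0 < n) (a : AddCircle (1 : ℚ)) :
    ∃ b, n • b = a :=
  ⟨DivisibleBy.div a (n : ℤ), by
    rw [← natCast_zsmul]
    exact DivisibleBy.div_cancel a (by exact_mod_cast hn.ne')⟩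

theorem exists_nsmul_eq_divisibleEnvelope {G : Type u} [AddCommGroup G] {n : ℕ} (hn : 0 < n)
    (a : DivisibleEnvelope G) : ∃ b, n • b = a := by
  choose b hb using fun c => exists_nsmul_eq_addCircle hn (a c)
  exact ⟨b, funext hb⟩

theorem exists_simple_riesz_embedding_of_pos (G : Type u) [AddCommGroup G] [PartialOrder G]
    [IsOrderedAddMonoid G] (hG : IsSimplePOGroup G) {e : G} (he : 0 < e) :
    ∃ (H : Type u) (_ : AddCommGroup H) (_ : PartialOrder H) (_ : IsOrderedAddMonoid H),
      IsSimplePOGroup H ∧ IsRieszGroup H ∧ HasDivisiblePositiveCone H ∧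
        ∃ f : G →+ H, Function.Injective f ∧ ∀ x y : G, f x ≤ f y ↔ x ≤ y := by
  let D := DivisibleEnvelope G
  let X := D × ℕ
  -- `ℚ` supplies free elements for interpolants, `ℚ/ℤ` torsion of every order for roots. Both are
  -- divisible and countable.
  let F := ℚ × AddCircle (1 : ℚ)
  let V := D × (ℕ × X →₀ F)
  have : Countable (AddCircle (1 : ℚ)) :=
    (QuotientAddGroup.mk_surjective (s := AddSubgroup.zmultiples (1 : ℚ))).countable
  let ι : G →+ V := (AddMonoidHom.inl D (ℕ × X →₀ F)).comp (toDivisibleEnvelope G)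
  have hι : Function.Injective ι := fun x y h =>
    toDivisibleEnvelope_injective G (Prod.mk.inj h).1
  have hι0 : ∀ x, ι x ∈ level D X F 0 := fun _ _ _ _ => rfl
  let C₀ : AddSubmonoid V := (AddSubmonoid.nonneg G).map ι
  have hC₀ : ∀ {x}, ι x ∈ C₀ ↔ 0 ≤ x := by
    intro x
    constructor
    · rintro ⟨y, hy, hyx⟩
      exact hι hyx ▸ hy
    · exact fun hx => ⟨x, hx, rfl⟩
  have hsimple : IsSimpleCone (ι e) C₀ := by
    refine ⟨hC₀.2 he.le, fun h => he.ne' (hι (h.trans (map_zero ι).symm)), ?_, ?_, ?_⟩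
    · rintro _ ⟨x, hx, rfl⟩ hx'
      rw [← map_neg, hC₀, neg_nonneg] at hx'
      rw [le_antisymm hx' hx, map_zero]
    · rintro _ ⟨x, hx, rfl⟩ hne
      have hx0 : 0 < x := lt_of_le_of_ne hx fun h => hne (by rw [← h, map_zero])
      obtain ⟨n, -, hn⟩ := (hG x hx0).2 e
      exact ⟨n, by rw [← map_nsmul, ← map_sub, hC₀]; exact sub_nonneg.2 hn⟩
    · rintro _ ⟨x, hx, rfl⟩
      obtain ⟨n, -, hn⟩ := (hG e he).2 x
      exact ⟨n, by rw [← map_nsmul, ← map_sub, hC₀]; exact sub_nonneg.2 hn⟩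
  have hC₀level : ∀ p ∈ C₀, p ∈ level D X F 0 := by
    rintro _ ⟨x, -, rfl⟩
    exact hι0 x
  obtain ⟨τ, hτ⟩ := exists_injective_of_countable (D := D) (X := X) (F := F)
    (Cardinal.mk_le_of_injective (Prod.mk_left_injective (0 : ℕ)))
  obtain ⟨C, hC, hle, hrestrict, hsolve⟩ := exists_isSimpleCone_solvesProblems
    (u := ι e) (W := level D X F) level_mono exists_mem_level
    (exists_isSimpleExtension_solvesProblems
      (fun n hn => exists_nsmul_eq_divisibleEnvelope hn)
      (fun n hn a => by
        obtain ⟨b, hb⟩ := exists_nsmul_eq_addCircle hn a.2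
        refine ⟨(a.1 / n, b), Prod.ext ?_ hb⟩
        have : (n : ℚ) ≠ 0 := by exact_mod_cast hn.ne'
        simp only [Prod.smul_mk, nsmul_eq_mul]
        field_simp)
      ⟨(1, 0), fun m hm => by simpa using congrArg Prod.fst hm⟩
      (fun n hn => ⟨(0, ((1 / n : ℚ) : AddCircle (1 : ℚ))), by
        rw [Prod.addOrderOf_mk, addOrderOf_zero, Nat.lcm_one_left]
        exact AddCircle.addOrderOf_period_div hn⟩) hτ)
    hsimple hC₀level
  obtain ⟨_, _, h₁, h₂, h₃, hord⟩ := hC.exists_simple_riesz_group hsolve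
  have hmem : ∀ x, ι x ∈ AddSubgroup.closure (C : Set V) := by
    intro x
    obtain ⟨n, -, hn⟩ := (hG e he).2 x
    have hsub : ∀ {y}, 0 ≤ y → ι y ∈ AddSubgroup.closure (C : Set V) := fun hy =>
      AddSubgroup.subset_closure (hle (hC₀.2 hy))
    have := AddSubgroup.sub_mem _ (hsub (nsmul_nonneg he.le n)) (hsub (sub_nonneg.2 hn))
    rwa [← map_sub, sub_sub_cancel] at this
  refine ⟨ConeGroup C, inferInstance, inferInstance, inferInstance, h₁, h₂, h₃,
    ι.codRestrict _ hmem, fun x y h => hι (congrArg Subtype.val h), fun x y => ?_⟩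
  rw [hord]
  change ι y - ι x ∈ C ↔ _
  rw [← map_sub, ← sub_nonneg, ← hC₀]
  exact ⟨fun h => hrestrict _ h (hι0 _), fun h => hle h⟩

/-- With no positive element in `G`, being positive in `ℤ ×ₗ G` means having a positive integer
coordinate. -/
theorem isSimplePOGroup_lex_int {G : Type u} [AddCommGroup G] [PartialOrder G]
    (hG : ∀ e : G, ¬ 0 < e) : IsSimplePOGroup (ℤ ×ₗ G) := by
  intro e he
  refine ⟨he.le, fun x => ?_⟩
  have he1 : 0 < (ofLex e).1 := by
    rcases Prod.Lex.lt_iff.1 he with h | ⟨-, h⟩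
    · exact h
    · exact absurd h (hG _)
  refine ⟨(ofLex x).1.toNat + 1, Nat.succ_pos _, Prod.Lex.le_iff.2 (Or.inl ?_)⟩
  have h1 : ∀ n : ℕ, (ofLex (n • e)).1 = n * (ofLex e).1 := fun n => nsmul_eq_mul n (ofLex e).1
  rw [h1]
  push_cast
  have := Int.self_le_toNat (ofLex x).1
  nlinarith

end Embedding

theorem corollary2p8 (G : Type u) [AddCommGroup G] [PartialOrder G] [IsOrderedAddMonoid G]
    (hG : IsSimplePOGroup G) :
    ∃ (H : Type u) (_ : AddCommGroup H) (_ : PartialOrder H) (_ : IsOrderedAddMonoid H),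
      IsSimplePOGroup H ∧ IsRieszGroup H ∧ HasDivisiblePositiveCone H ∧
        ∃ f : G →+ H, Function.Injective f ∧ ∀ x y : G, f x ≤ f y ↔ x ≤ y := by
  by_cases h : ∃ e : G, 0 < e
  · obtain ⟨e, he⟩ := h
    exact exists_simple_riesz_embedding_of_pos G hG he
  -- Without a positive element there is no unit to start from. The lexicographic product supplies
  -- one and induces the given order on `G`.
  · push Not at h
    have hpos : (0 : ℤ ×ₗ G) < toLex (1, 0) := Prod.Lex.lt_iff.2 (Or.inl Int.one_pos)
    obtain ⟨H, i₁, i₂, i₃, h₁, h₂, h₃, f, hf, hfle⟩ :=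
      exists_simple_riesz_embedding_of_pos (ℤ ×ₗ G) (isSimplePOGroup_lex_int h) hpos
    let j : G →+ ℤ ×ₗ G :=
      { toFun := fun g => toLex (0, g)
        map_zero' := rfl
        map_add' := fun _ _ => rfl }
    refine ⟨H, i₁, i₂, i₃, h₁, h₂, h₃, f.comp j, fun x y hxy => ?_, fun x y => ?_⟩
    · exact (Prod.mk.inj (toLex.injective (hf hxy))).2
    · rw [AddMonoidHom.comp_apply, AddMonoidHom.comp_apply, hfle, Prod.Lex.le_iff]
      exact ⟨fun hxy => hxy.resolve_left (lt_irrefl _) |>.2, fun hxy => Or.inr ⟨rfl, hxy⟩⟩
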